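/- Let $T$ be a finite tree. Call a vertex of $T$ a leaf if its degree is $1$, penultimate if it is adjacent to a leaf, and deep if it is neither a leaf nor penultimate. Let $\gamma(T)$ denote the domination number of $T$, that is, the smallest size of a set $D$ of vertices such that every vertex of $T$ is in $D$ or adjacent to a vertex of $D$. Let $\mu(T)$ denote the number of eigenvalues, counted with multiplicity, of the Laplacian matrix of $T$ (the diagonal matrix of vertex degrees minus the adjacency matrix) in the interval $[0,1)$. Let $k \geq 3$ be an integer. If every deep vertex of $T$ has degree at least $k$, then \[1 \leq \frac{\gamma(T)}{\mu(T)} < 1 + \frac{1}{(k-2)(k+1)}.\] -/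

import Mathlib

namespace SimpleGraph

/-- A set `D` of vertices is dominating if every vertex is in `D` or adjacent to a vertex of `D`. -/
def IsDominatingSet {V : Type*} (G : SimpleGraph V) (D : Finset V) : Prop :=
  ∀ v : V, v ∈ D ∨ ∃ u ∈ D, G.Adj v u

/-- The domination number: the size of a smallest dominating set. On a finite vertex set the
infimum is a minimum, since the set of all vertices is dominating. -/
noncomputable def dominationNumber {V : Type*} (G : SimpleGraph V) : ℕ :=
  sInf {n : ℕ | ∃ D : Finset V, G.IsDominatingSet D ∧ D.card = n}

open Classical in
/-- The number of eigenvalues of the (real) Laplacian matrix of `G` in the set `I`, counted with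
multiplicity. -/
noncomputable def laplacianEigenvalueCount {V : Type*} [Fintype V] [DecidableEq V]
    (G : SimpleGraph V) [DecidableRel G.Adj] (I : Set ℝ) : ℕ :=
  (Finset.univ.filter fun i : V => (G.isHermitian_lapMatrix ℝ).eigenvalues i ∈ I).card

/-- `μ(G)`: the number of Laplacian eigenvalues of `G` in `[0, 1)`, counted with multiplicity. -/
noncomputable def laplacianMu {V : Type*} [Fintype V] [DecidableEq V]
    (G : SimpleGraph V) [DecidableRel G.Adj] : ℕ :=
  G.laplacianEigenvalueCount (Set.Ico 0 1)

/-- A leaf is a vertex of degree `1`. -/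
def IsLeaf {V : Type*} [Fintype V] (G : SimpleGraph V) [DecidableRel G.Adj] (v : V) : Prop :=
  G.degree v = 1

/-- A penultimate vertex is a vertex adjacent to a leaf. -/
def IsPenultimate {V : Type*} [Fintype V] (G : SimpleGraph V) [DecidableRel G.Adj]
    (v : V) : Prop :=
  ∃ u : V, G.Adj v u ∧ G.IsLeaf u

/-- A deep vertex is a vertex that is neither a leaf nor penultimate. -/
def IsDeep {V : Type*} [Fintype V] (G : SimpleGraph V) [DecidableRel G.Adj] (v : V) : Prop :=
  ¬ G.IsLeaf v ∧ ¬ G.IsPenultimate v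

end SimpleGraph

/-! Let `p` and `d` count the penultimate and the deep vertices. The Laplacian form is at least the
squared norm on vectors vanishing on a dominating set `D`, a space of codimension at most `#D`; by
min-max, `μ ≤ γ`. For the upper bound, if no leaf is penultimate, pair each penultimate vertex with
one of its leaves. Test vectors weighted heavily on these leaves give `p ≤ μ`
(`card_le_laplacianMu_of_pendant`). Penultimate vertices dominate all but the deep vertices with no
penultimate neighbour. By tree duality between covering and packing
(`IsTree.exists_dominating_packing`), some `m` vertices dominate these, where at least `m` of them
have disjoint closed neighbourhoods. Each such neighbourhood consists of at least `k + 1` deep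
vertices, so `m (k + 1) ≤ d`. Counting degrees gives `(k - 2) d < p`. Hence `γ - μ ≤ m < μ / ((k -
2) (k + 1))`. -/

open Matrix

/-! ### Min-max bounds for counting eigenvalues -/

namespace Matrix.IsHermitian

variable {n : Type*} [Fintype n] [DecidableEq n] {A : Matrix n n ℝ}

lemma dotProduct_eigenvectorUnitary_mulVec (hA : A.IsHermitian) (y z : n → ℝ) :
    ((hA.eigenvectorUnitary : Matrix n n ℝ) *ᵥ y) ⬝ᵥ ((hA.eigenvectorUnitary : Matrix n n ℝ) *ᵥ z)
      = y ⬝ᵥ z := by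
  have h : (hA.eigenvectorUnitary : Matrix n n ℝ)ᵀ * (hA.eigenvectorUnitary : Matrix n n ℝ) = 1 := by
    simpa [star_eq_conjTranspose, conjTranspose_eq_transpose_of_trivial] using
      Unitary.coe_star_mul_self hA.eigenvectorUnitary
  rw [dotProduct_mulVec, ← mulVec_transpose, mulVec_mulVec, h, one_mulVec]

lemma mulVec_eigenvectorUnitary_mulVec (hA : A.IsHermitian) (y : n → ℝ) :
    A *ᵥ ((hA.eigenvectorUnitary : Matrix n n ℝ) *ᵥ y) =
      (hA.eigenvectorUnitary : Matrix n n ℝ) *ᵥ (fun i ↦ hA.eigenvalues i * y i) := by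
  have h : A * (hA.eigenvectorUnitary : Matrix n n ℝ) =
      (hA.eigenvectorUnitary : Matrix n n ℝ) * diagonal hA.eigenvalues := by
    ext i j
    have := congrFun (hA.mulVec_eigenvectorBasis j) i
    rw [mul_diagonal]
    simpa [mul_apply, mulVec, dotProduct, mul_comm] using this
  rw [mulVec_mulVec, h, ← mulVec_mulVec]
  congr 1
  ext i
  simp [mulVec_diagonal]

lemma quadraticForm_eigenvectorUnitary_mulVec (hA : A.IsHermitian) (y : n → ℝ) :
    ((hA.eigenvectorUnitary : Matrix n n ℝ) *ᵥ y) ⬝ᵥ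
      (A *ᵥ ((hA.eigenvectorUnitary : Matrix n n ℝ) *ᵥ y)) = ∑ i, hA.eigenvalues i * y i ^ 2 := by
  rw [mulVec_eigenvectorUnitary_mulVec, dotProduct_eigenvectorUnitary_mulVec]
  exact Finset.sum_congr rfl fun i _ ↦ by ring

lemma eigenvectorUnitary_mulVec_star_mulVec (hA : A.IsHermitian) (x : n → ℝ) :
    (hA.eigenvectorUnitary : Matrix n n ℝ) *ᵥ
      ((star (hA.eigenvectorUnitary : Matrix n n ℝ)) *ᵥ x) = x := by
  rw [mulVec_mulVec, Unitary.mul_star_self_of_mem hA.eigenvectorUnitary.2, one_mulVec]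

/-- A space of vectors on which the quadratic form lies below `c` has dimension at most the number
of eigenvalues below `c`. -/
lemma card_le_card_eigenvalues_lt (hA : A.IsHermitian) {c : ℝ} {ι : Type*} [Fintype ι]
    (f : (ι → ℝ) →ₗ[ℝ] (n → ℝ)) (hf : ∀ a ≠ 0, f a ⬝ᵥ (A *ᵥ f a) < c * (f a ⬝ᵥ f a)) :
    Fintype.card ι ≤ Fintype.card {i // hA.eigenvalues i < c} := by
  let g : (n → ℝ) →ₗ[ℝ] ({i // hA.eigenvalues i < c} → ℝ) :=
    (LinearMap.funLeft ℝ ℝ Subtype.val) ∘ₗ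
      (star (hA.eigenvectorUnitary : Matrix n n ℝ)).mulVecLin
  -- A vector with no component along the eigenvectors below `c` has form at least `c` times its
  -- squared norm.
  have hinj : Function.Injective (g ∘ₗ f) := by
    rw [injective_iff_map_eq_zero]
    intro a ha
    by_contra hne
    have h := hf a hne
    set y := (star (hA.eigenvectorUnitary : Matrix n n ℝ)) *ᵥ (f a) with hy
    have hx := hA.eigenvectorUnitary_mulVec_star_mulVec (f a)
    rw [← hy] at hx
    rw [← hx, quadraticForm_eigenvectorUnitary_mulVec, dotProduct_eigenvectorUnitary_mulVec,
      dotProduct, Finset.mul_sum] at h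
    refine h.not_ge (Finset.sum_le_sum fun i _ ↦ ?_)
    by_cases hi : hA.eigenvalues i < c
    · have : y i = 0 := congrFun ha ⟨i, hi⟩
      simp [this]
    · nlinarith [sq_nonneg (y i)]
  simpa using LinearMap.finrank_le_finrank_of_injective hinj

/-- If the quadratic form is at least `c` on the vectors vanishing on `D`, then at most `#D`
eigenvalues lie below `c`. -/
lemma card_eigenvalues_lt_le_card (hA : A.IsHermitian) {c : ℝ} (D : Finset n)
    (hD : ∀ x : n → ℝ, (∀ i ∈ D, x i = 0) → c * (x ⬝ᵥ x) ≤ x ⬝ᵥ (A *ᵥ x)) :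
    Fintype.card {i // hA.eigenvalues i < c} ≤ D.card := by
  let g : ({i // hA.eigenvalues i < c} → ℝ) →ₗ[ℝ] (D → ℝ) :=
    (LinearMap.funLeft ℝ ℝ Subtype.val) ∘ₗ (hA.eigenvectorUnitary : Matrix n n ℝ).mulVecLin ∘ₗ
      Function.ExtendByZero.linearMap ℝ Subtype.val
  -- On the span of the eigenvectors below `c` the form is strictly smaller than `c` times the
  -- squared norm, except at zero; so only zero vanishes on `D`.
  have hinj : Function.Injective g := by
    rw [injective_iff_map_eq_zero]
    intro a ha
    set y : n → ℝ := Function.ExtendByZero.linearMap ℝ Subtype.val a with hy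
    have hya : ∀ i : {i // hA.eigenvalues i < c}, y i = a i := fun i ↦
      Subtype.val_injective.extend_apply _ _ _
    have hy0 : ∀ i, ¬ hA.eigenvalues i < c → y i = 0 := fun i hi ↦
      Function.extend_apply' _ _ _ fun ⟨j, hj⟩ ↦ hi (hj ▸ j.2)
    have h := hD ((hA.eigenvectorUnitary : Matrix n n ℝ) *ᵥ y) fun i hi ↦ congrFun ha ⟨i, hi⟩
    rw [quadraticForm_eigenvectorUnitary_mulVec, dotProduct_eigenvectorUnitary_mulVec,
      dotProduct, Finset.mul_sum, ← sub_nonneg, ← Finset.sum_sub_distrib] at h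
    have hle : ∀ i ∈ Finset.univ, hA.eigenvalues i * y i ^ 2 - c * (y i * y i) ≤ 0 := by
      intro i _
      by_cases hi : hA.eigenvalues i < c
      · nlinarith [sq_nonneg (y i)]
      · simp [hy0 i hi]
    have h0 := (Finset.sum_eq_zero_iff_of_nonpos hle).1 (le_antisymm (Finset.sum_nonpos hle) h)
    ext i
    have := h0 i (Finset.mem_univ _)
    rw [hya] at this
    have h2 : (hA.eigenvalues i - c) * (a i * a i) = 0 := by linarith
    rcases mul_eq_zero.1 h2 with h3 | h3
    · linarith [i.2]
    · simpa using h3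
  simpa using LinearMap.finrank_le_finrank_of_injective hinj

end Matrix.IsHermitian

/-! ### Laplacian test vectors -/

namespace SimpleGraph

section Laplacian

variable {V : Type*} [Fintype V] [DecidableEq V] (G : SimpleGraph V) [DecidableRel G.Adj]

lemma laplacianMu_eq_card :
    G.laplacianMu = Fintype.card {i // (G.isHermitian_lapMatrix ℝ).eigenvalues i < 1} := by
  rw [laplacianMu, laplacianEigenvalueCount, Fintype.card_subtype]
  congr 1
  ext i
  simp [(posSemidef_lapMatrix ℝ G).eigenvalues_nonneg i]

lemma dotProduct_lapMatrix_mulVec (x : V → ℝ) :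
    x ⬝ᵥ (G.lapMatrix ℝ *ᵥ x) = (∑ i, ∑ j, if G.Adj i j then (x i - x j) ^ 2 else 0) / 2 := by
  rw [← toLinearMap₂'_apply', lapMatrix_toLinearMap₂']

omit [DecidableEq V] [DecidableRel G.Adj] in
lemma exists_isDominatingSet_card_eq :
    ∃ D : Finset V, G.IsDominatingSet D ∧ D.card = G.dominationNumber :=
  Nat.sInf_mem (s := {n : ℕ | ∃ D : Finset V, G.IsDominatingSet D ∧ D.card = n})
    ⟨_, Finset.univ, fun v ↦ Or.inl (Finset.mem_univ v), rfl⟩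

omit [Fintype V] [DecidableEq V] [DecidableRel G.Adj] in
variable {G} in
lemma IsDominatingSet.dominationNumber_le {D : Finset V} (hD : G.IsDominatingSet D) :
    G.dominationNumber ≤ D.card := Nat.sInf_le ⟨D, hD, rfl⟩

-- Each vertex `i` outside `D` has an edge into `D`, whose energy is exactly `x i ^ 2`; distinct
-- vertices use distinct edges.
variable {G} in
lemma IsDominatingSet.dotProduct_self_le {D : Finset V} (hD : G.IsDominatingSet D) (x : V → ℝ)
    (hx : ∀ i ∈ D, x i = 0) : x ⬝ᵥ x ≤ x ⬝ᵥ (G.lapMatrix ℝ *ᵥ x) := by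
  rw [dotProduct_lapMatrix_mulVec]
  have key : ∀ i, x i * x i ≤ ∑ j, if G.Adj i j ∧ j ∈ D then (x i - x j) ^ 2 else 0 := by
    intro i
    have h0 : ∀ j ∈ Finset.univ, 0 ≤ if G.Adj i j ∧ j ∈ D then (x i - x j) ^ 2 else 0 :=
      fun j _ ↦ by positivity
    rcases hD i with hi | ⟨u, hu, hiu⟩
    · rw [hx i hi, mul_zero]
      exact Finset.sum_nonneg (by simpa [hx i hi] using h0)
    · refine le_trans (le_of_eq ?_) (Finset.single_le_sum h0 (Finset.mem_univ u))
      simp [hiu, hu, hx u hu, sq]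
  have h1 : x ⬝ᵥ x ≤ ∑ i, ∑ j, if G.Adj i j ∧ j ∈ D then (x i - x j) ^ 2 else 0 :=
    Finset.sum_le_sum fun i _ ↦ key i
  have h2 : (∑ i, ∑ j, if G.Adj i j ∧ j ∈ D then (x i - x j) ^ 2 else 0) =
      ∑ i, ∑ j, if G.Adj i j ∧ i ∈ D then (x i - x j) ^ 2 else 0 := by
    rw [Finset.sum_comm]
    refine Finset.sum_congr rfl fun i _ ↦ Finset.sum_congr rfl fun j _ ↦ ?_
    simp only [G.adj_comm j i, sub_sq_comm (x j)]
  -- A pair counted in both sums has both ends in `D`, so its term is zero.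
  have h3 : (∑ i, ∑ j, if G.Adj i j ∧ j ∈ D then (x i - x j) ^ 2 else 0) +
      (∑ i, ∑ j, if G.Adj i j ∧ i ∈ D then (x i - x j) ^ 2 else 0) ≤
      ∑ i, ∑ j, if G.Adj i j then (x i - x j) ^ 2 else 0 := by
    simp_rw [← Finset.sum_add_distrib]
    refine Finset.sum_le_sum fun i _ ↦ Finset.sum_le_sum fun j _ ↦ ?_
    by_cases h : G.Adj i j <;> by_cases hi : i ∈ D <;> by_cases hj : j ∈ D <;>
      simp [h, hi, hj, hx, sq_nonneg]
  linarith

theorem laplacianMu_le_dominationNumber : G.laplacianMu ≤ G.dominationNumber := by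
  obtain ⟨D, hD, hcard⟩ := G.exists_isDominatingSet_card_eq
  rw [laplacianMu_eq_card, ← hcard]
  exact (G.isHermitian_lapMatrix ℝ).card_eigenvalues_lt_le_card D fun x hx ↦ by
    simpa using hD.dotProduct_self_le x hx

lemma dotProduct_lapMatrix_mulVec_le (x : V → ℝ) :
    x ⬝ᵥ (G.lapMatrix ℝ *ᵥ x) ≤ 2 * Fintype.card V * (x ⬝ᵥ x) := by
  rw [dotProduct_lapMatrix_mulVec]
  have h : (∑ i, ∑ j, if G.Adj i j then (x i - x j) ^ 2 else 0) ≤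
      ∑ i, ∑ j, (2 * x i ^ 2 + 2 * x j ^ 2) := by
    refine Finset.sum_le_sum fun i _ ↦ Finset.sum_le_sum fun j _ ↦ ?_
    split_ifs <;> nlinarith [sq_nonneg (x i + x j), sq_nonneg (x i), sq_nonneg (x j)]
  have h2 : ∑ i, ∑ j, (2 * x i ^ 2 + 2 * x j ^ 2) = 4 * Fintype.card V * (x ⬝ᵥ x) := by
    simp only [Finset.sum_add_distrib, Finset.sum_const, Finset.card_univ, nsmul_eq_mul,
      dotProduct, ← Finset.mul_sum, ← sq]
    ring
  linarith

omit [DecidableEq V] in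
lemma extendByZero_dotProduct {ι : Type*} [Fintype ι] {e : ι → V} (he : Function.Injective e)
    (a : ι → ℝ) (w : V → ℝ) :
    (Function.ExtendByZero.linearMap ℝ e a) ⬝ᵥ w = ∑ q, a q * w (e q) := by
  symm
  refine Fintype.sum_of_injective e he _ _ (fun i hi ↦ ?_) fun q ↦ ?_
  · rw [Function.ExtendByZero.linearMap_apply, Function.extend_apply' _ _ _ hi]
    simp
  · rw [Function.ExtendByZero.linearMap_apply, he.extend_apply]

lemma lapMatrix_mulVec_of_degree_eq_one {u v : V} (hu : G.degree u = 1) (huv : G.Adj u v)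
    (x : V → ℝ) : (G.lapMatrix ℝ *ᵥ x) u = x u - x v := by
  obtain ⟨w, hw⟩ := Finset.card_eq_one.1 hu
  have : v = w := by simpa [hw] using (G.mem_neighborFinset u v).2 huv
  rw [lapMatrix_mulVec_apply, hu, hw, this]
  simp

/-- Vertices attached to distinct pendant vertices contribute eigenvalues below `1`. -/
theorem card_le_laplacianMu_of_pendant {ι : Type*} [Fintype ι] {e l : ι → V}
    (he : Function.Injective e) (hadj : ∀ q, G.Adj (l q) (e q)) (hl : ∀ q, G.degree (l q) = 1)
    (hne : ∀ p q, e p ≠ l q) : Fintype.card ι ≤ G.laplacianMu := by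
  have hlinj : Function.Injective l := by
    intro p q hpq
    obtain ⟨w, hw⟩ := Finset.card_eq_one.1 (hl p)
    have h1 : e p = w := by simpa [hw] using (G.mem_neighborFinset _ _).2 (hadj p)
    have h2 : e q = w := by simpa [hw] using (G.mem_neighborFinset (l p) (e q)).2 (hpq ▸ hadj q)
    exact he (h1.trans h2.symm)
  rw [laplacianMu_eq_card]
  -- With `s = ∑ a q ^ 2`, the form is at most `t² s - 2 t s + 2 #V s`, against squared norm `t² s +
  -- s`; `t = #V` cancels the last two terms of the former.
  set t : ℝ := (Fintype.card V : ℝ)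
  refine (G.isHermitian_lapMatrix ℝ).card_le_card_eigenvalues_lt
    (Function.ExtendByZero.linearMap ℝ e + t • Function.ExtendByZero.linearMap ℝ l) fun a ha ↦ ?_
  set z : V → ℝ := Function.ExtendByZero.linearMap ℝ e a with hz
  set y : V → ℝ := Function.ExtendByZero.linearMap ℝ l a with hy
  have hze : ∀ q, z (e q) = a q := fun q ↦ he.extend_apply _ _ _
  have hyl : ∀ q, y (l q) = a q := fun q ↦ hlinj.extend_apply _ _ _
  have hzl : ∀ q, z (l q) = 0 := fun q ↦ Function.extend_apply' _ _ _ fun ⟨p, hp⟩ ↦ hne p q hp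
  have hye : ∀ q, y (e q) = 0 := fun q ↦
    Function.extend_apply' _ _ _ fun ⟨p, hp⟩ ↦ hne q p hp.symm
  have hpos : 0 < ∑ q, a q * a q := by
    obtain ⟨q, hq⟩ := Function.ne_iff.1 ha
    exact Finset.sum_pos' (fun i _ ↦ mul_self_nonneg _) ⟨q, Finset.mem_univ _,
      mul_self_pos.2 hq⟩
  have hzz : z ⬝ᵥ z = ∑ q, a q * a q := by rw [hz, extendByZero_dotProduct he, ← hz]; simp [hze]
  have hyy : y ⬝ᵥ y = ∑ q, a q * a q := by
    rw [hy, extendByZero_dotProduct hlinj, ← hy]; simp [hyl]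
  have hyz : y ⬝ᵥ z = 0 := by rw [hy, extendByZero_dotProduct hlinj]; simp [hzl]
  have hyLy : y ⬝ᵥ (G.lapMatrix ℝ *ᵥ y) = ∑ q, a q * a q := by
    nth_rw 1 [hy]
    rw [extendByZero_dotProduct hlinj]
    simp [G.lapMatrix_mulVec_of_degree_eq_one (hl _) (hadj _), hyl, hye]
  have hyLz : y ⬝ᵥ (G.lapMatrix ℝ *ᵥ z) = -∑ q, a q * a q := by
    rw [hy, extendByZero_dotProduct hlinj]
    simp [G.lapMatrix_mulVec_of_degree_eq_one (hl _) (hadj _), hzl, hze]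
  have hzLy : z ⬝ᵥ (G.lapMatrix ℝ *ᵥ y) = -∑ q, a q * a q := by
    rw [← hyLz, dotProduct_mulVec, ← mulVec_transpose, (G.isSymm_lapMatrix (R := ℝ)).eq, dotProduct_comm]
  have hzLz := G.dotProduct_lapMatrix_mulVec_le z
  simp only [LinearMap.add_apply, LinearMap.smul_apply, ← hz, ← hy, mulVec_add, mulVec_smul,
    add_dotProduct, dotProduct_add, smul_dotProduct, dotProduct_smul, smul_eq_mul,
    dotProduct_comm z y, hyz, hyy, hzz, hyLy, hyLz, hzLy] at hzLz ⊢
  linarith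

/-- Constant vectors have zero energy. -/
lemma laplacianMu_pos [Nonempty V] : 0 < G.laplacianMu := by
  rw [laplacianMu_eq_card]
  have := (G.isHermitian_lapMatrix ℝ).card_le_card_eigenvalues_lt (c := 1) (ι := Unit)
    (LinearMap.pi fun _ ↦ LinearMap.proj ()) fun a ha ↦ by
      have ha' : a () ≠ 0 := fun h ↦ ha (funext fun _ ↦ h)
      rw [dotProduct_lapMatrix_mulVec]
      simp [dotProduct, mul_self_pos.2 ha', Fintype.card_pos]
  exact Nat.lt_of_lt_of_le (by simp) this

end Laplacian
end SimpleGraph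

/-! ### Covering and packing in trees -/

namespace SimpleGraph

variable {V : Type*}

lemma IsTree.eq_of_adj_of_dist_eq_add_one {T : SimpleGraph V} (hT : T.IsTree) {r v a b : V}
    (ha : T.Adj a v) (hb : T.Adj b v) (hda : T.dist r v = T.dist r a + 1)
    (hdb : T.dist r v = T.dist r b + 1) : a = b := by
  obtain ⟨p, hp⟩ := hT.connected.exists_walk_length_eq_dist r a
  obtain ⟨q, hq⟩ := hT.connected.exists_walk_length_eq_dist r b
  have hp' : (p.concat ha).IsPath :=
    Walk.isPath_of_length_eq_dist _ (by rw [Walk.length_concat, hp, hda])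
  have hq' : (q.concat hb).IsPath :=
    Walk.isPath_of_length_eq_dist _ (by rw [Walk.length_concat, hq, hdb])
  have h := (hT.existsUnique_path r v).unique hp' hq'
  simpa using congrArg Walk.penultimate h

/-- In a tree, any set of vertices contains a subset of vertices with pairwise disjoint closed
neighbourhoods that is as large as some set dominating the given one. -/
theorem IsTree.exists_dominating_packing [DecidableEq V] {T : SimpleGraph V} (hT : T.IsTree)
    (U : Finset V) :
    ∃ X Y : Finset V, X.card ≤ Y.card ∧ Y ⊆ U ∧
      (∀ u ∈ U, u ∈ X ∨ ∃ x ∈ X, T.Adj u x) ∧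
      ∀ y ∈ Y, ∀ y' ∈ Y, ∀ z, (z = y ∨ T.Adj z y) → (z = y' ∨ T.Adj z y') → y = y' := by
  classical
  obtain ⟨r⟩ := hT.connected.nonempty
  induction U using Finset.strongInduction with
  | H U ih =>
    rcases U.eq_empty_or_nonempty with rfl | hU
    · exact ⟨∅, ∅, by simp⟩
    obtain ⟨u, huU, hmax⟩ := U.exists_max_image (T.dist r) hU
    -- Greedy choice: `u` is a vertex of `U` farthest from the root and `w` is its parent, or `u`
    -- itself at the root. Put `w` in `X`, `u` in `Y`, and discard the closed neighbourhood of `w`.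
    obtain ⟨w, hw, hwd⟩ : ∃ w, (w = u ∨ T.Adj w u) ∧
        ∀ z, T.Adj z u → T.dist r z < T.dist r u → z = w := by
      by_cases h : ∃ w, T.Adj w u ∧ T.dist r w < T.dist r u
      · obtain ⟨w, hw, hlt⟩ := h
        refine ⟨w, Or.inr hw, fun z hz hzlt ↦ hT.eq_of_adj_of_dist_eq_add_one (r := r) hz hw ?_ ?_⟩
        · have := hT.dist_eq_dist_add_one_of_adj r hz
          omega
        · have := hT.dist_eq_dist_add_one_of_adj r hw
          omega
      · push Not at h
        exact ⟨u, Or.inl rfl, fun z hz hlt ↦ absurd hlt (h z hz).not_gt⟩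
    have hss : U.filter (fun v ↦ ¬ (v = w ∨ T.Adj v w)) ⊂ U := by
      refine Finset.filter_ssubset.2 ⟨u, huU, ?_⟩
      rw [not_not]
      exact hw.imp Eq.symm Adj.symm
    obtain ⟨X, Y, hcard, hYU, hdom, hpack⟩ := ih _ hss
    -- A shared `z` is not `w`, so it is `u` or a child of `u`. Then `y` is deeper than `u`, or
    -- equals `u`, or is adjacent to `u` through its parent `w`; all are excluded.
    have hnew : ∀ y ∈ Y, ∀ z, (z = u ∨ T.Adj z u) → (z = y ∨ T.Adj z y) → False := by
      intro y hy z hzu hzy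
      obtain ⟨hyU, hyw⟩ := Finset.mem_filter.1 (hYU hy)
      have hyd := hmax y hyU
      have hzw : z ≠ w := fun h ↦ hyw (hzy.imp (fun e ↦ e.symm.trans h) fun e ↦ h ▸ e.symm)
      have hyu : y ≠ u := fun h ↦ hyw (h ▸ hw.imp Eq.symm Adj.symm)
      have hbelow : ∀ v, T.Adj v u → v ≠ w → T.dist r v = T.dist r u + 1 := by
        intro v hv hvw
        have h1 := hT.dist_eq_dist_add_one_of_adj r hv
        have h2 : ¬ T.dist r v < T.dist r u := fun h ↦ hvw (hwd v hv h)
        omega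
      rcases hzu with rfl | hzu
      · rcases hzy with h | h
        · exact hyu h.symm
        · have := hbelow y h.symm fun e ↦ hyw (Or.inl e)
          omega
      · have hz := hbelow z hzu hzw
        rcases hzy with rfl | hzy
        · omega
        · have h1 := hT.dist_eq_dist_add_one_of_adj r hzy
          exact hyu (hT.eq_of_adj_of_dist_eq_add_one (r := r) hzy.symm hzu.symm (by omega) hz)
    have huY : u ∉ Y := fun h ↦ hnew u h u (Or.inl rfl) (Or.inl rfl)
    refine ⟨insert w X, insert u Y, ?_, ?_, ?_, ?_⟩
    · rw [Finset.card_insert_of_notMem huY]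
      exact (Finset.card_insert_le _ _).trans (by omega)
    · exact Finset.insert_subset huU (hYU.trans (Finset.filter_subset _ _))
    · intro v hv
      by_cases hvw : v = w ∨ T.Adj v w
      · rcases hvw with h | h
        · exact Or.inl (h ▸ Finset.mem_insert_self _ _)
        · exact Or.inr ⟨w, Finset.mem_insert_self _ _, h⟩
      · rcases hdom v (Finset.mem_filter.2 ⟨hv, hvw⟩) with h | ⟨x, hx, h⟩
        · exact Or.inl (Finset.mem_insert_of_mem h)
        · exact Or.inr ⟨x, Finset.mem_insert_of_mem hx, h⟩
    · intro y hy y' hy' z hz hz'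
      rcases Finset.mem_insert.1 hy with h | h <;> rcases Finset.mem_insert.1 hy' with h' | h'
      · exact h.trans h'.symm
      · exact (hnew y' h' z (h ▸ hz) hz').elim
      · exact (hnew y h z (h' ▸ hz') hz).elim
      · exact hpack y h y' h' z hz hz'

/-! ### Counting deep and penultimate vertices -/

section Fintype

variable [Fintype V] [DecidableEq V] {T : SimpleGraph V} [DecidableRel T.Adj]

omit [DecidableEq V] in
lemma IsLeaf.eq_of_adj {u v w : V} (hu : T.IsLeaf u) (hv : T.Adj u v) (hw : T.Adj u w) :
    v = w := by
  obtain ⟨x, hx⟩ := Finset.card_eq_one.1 hu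
  have h1 : v = x := by simpa [hx] using (T.mem_neighborFinset u v).2 hv
  have h2 : w = x := by simpa [hx] using (T.mem_neighborFinset u w).2 hw
  exact h1.trans h2.symm

omit [DecidableEq V] in
/-- If all neighbours of `q` are leaves, the graph is a star centred at `q`. -/
lemma IsTree.eq_or_adj_of_forall_adj_isLeaf (hT : T.IsTree) {q : V}
    (hq : ∀ u, T.Adj q u → T.IsLeaf u) (v : V) : v = q ∨ T.Adj q v := by
  obtain ⟨p⟩ := hT.connected q v
  induction p using Walk.concatRec with
  | Hnil => exact Or.inl rfl
  | Hconcat p h ih =>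
    rcases ih hq with rfl | h'
    · exact Or.inr h
    · exact Or.inl ((hq _ h').eq_of_adj h h'.symm)

open Classical in
/-- The deep vertices are few: count edges by degrees. -/
theorem IsTree.mul_card_deep_lt_card_penultimate (hT : T.IsTree)
    (hlp : ∀ v, T.IsLeaf v → ¬ T.IsPenultimate v) {k : ℕ} (hk : 3 ≤ k)
    (hdeep : ∀ v, T.IsDeep v → k ≤ T.degree v) :
    (k - 2) * (Finset.univ.filter T.IsDeep).card < (Finset.univ.filter T.IsPenultimate).card := by
  obtain ⟨r⟩ := hT.connected.nonempty
  set P := Finset.univ.filter T.IsPenultimate with hP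
  set F := Finset.univ.filter T.IsDeep with hF
  set S := Finset.univ.filter T.IsLeaf with hS
  rcases F.eq_empty_or_nonempty with h0 | ⟨f, hf⟩
  · rw [h0, Finset.card_empty, mul_zero, Finset.card_pos]
    by_contra hne
    rw [Finset.not_nonempty_iff_eq_empty, hP, Finset.filter_eq_empty_iff] at hne
    have hr : T.IsLeaf r := by
      by_contra hr
      exact (Finset.eq_empty_iff_forall_notMem.1 h0 r) (by simp [hF, IsDeep, hr, hne])
    obtain ⟨x, hx⟩ := Finset.card_pos.1 (show 0 < T.degree r from hr ▸ one_pos)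
    exact hne (Finset.mem_univ x) ⟨r, ((T.mem_neighborFinset _ _).1 hx).symm, hr⟩
  have hfd : T.IsDeep f := (Finset.mem_filter.1 hf).2
  -- Otherwise the tree is a star centred at `q`, with no room for the deep vertex `f`.
  have hnl : ∀ q ∈ P, ∃ u, T.Adj q u ∧ ¬ T.IsLeaf u := by
    intro q hq
    have hq' : T.IsPenultimate q := (Finset.mem_filter.1 hq).2
    by_contra! h
    rcases hT.eq_or_adj_of_forall_adj_isLeaf h f with rfl | h'
    · exact hfd.2 hq'
    · exact hfd.1 (h f h')
  have hsplit : ∀ g : V → ℕ, ∑ v, g v = ∑ v ∈ S, g v + ∑ v ∈ P, g v + ∑ v ∈ F, g v := by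
    intro g
    rw [hS, hP, hF, Finset.sum_filter, Finset.sum_filter, Finset.sum_filter,
      ← Finset.sum_add_distrib, ← Finset.sum_add_distrib]
    refine Finset.sum_congr rfl fun v _ ↦ ?_
    by_cases h1 : T.IsLeaf v
    · simp [h1, hlp v h1, IsDeep]
    · by_cases h2 : T.IsPenultimate v <;> simp [h1, h2, IsDeep]
  -- Every leaf hangs from a vertex of `P`, and each vertex of `P` has a further non-leaf neighbour.
  have hPdeg : S.card + P.card ≤ ∑ v ∈ P, T.degree v := by
    have h1 : S.card ≤ ∑ v ∈ P, ((T.neighborFinset v).filter T.IsLeaf).card := by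
      refine le_trans (Finset.card_le_card fun l hl ↦ ?_) Finset.card_biUnion_le
      have hl' : T.IsLeaf l := (Finset.mem_filter.1 hl).2
      obtain ⟨x, hx⟩ := Finset.card_pos.1 (show 0 < T.degree l from hl' ▸ one_pos)
      have hx' := ((T.mem_neighborFinset _ _).1 hx).symm
      exact Finset.mem_biUnion.2 ⟨x, Finset.mem_filter.2 ⟨Finset.mem_univ _, l, hx', hl'⟩, by
        simp [hx', hl']⟩
    have h2 : P.card ≤ ∑ v ∈ P, ((T.neighborFinset v).filter (¬ T.IsLeaf ·)).card := by
      rw [Finset.card_eq_sum_ones]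
      refine Finset.sum_le_sum fun q hq ↦ Finset.card_pos.2 ?_
      obtain ⟨u, hu, hul⟩ := hnl q hq
      exact ⟨u, by simp [hu, hul]⟩
    have h3 : ∑ v ∈ P, T.degree v = ∑ v ∈ P, ((T.neighborFinset v).filter T.IsLeaf).card +
        ∑ v ∈ P, ((T.neighborFinset v).filter (¬ T.IsLeaf ·)).card := by
      rw [← Finset.sum_add_distrib]
      exact Finset.sum_congr rfl fun v _ ↦ (Finset.card_filter_add_card_filter_not _).symm
    omega
  have hSdeg : ∑ v ∈ S, T.degree v = S.card := by
    rw [Finset.card_eq_sum_ones]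
    exact Finset.sum_congr rfl fun v hv ↦ (Finset.mem_filter.1 hv).2
  have hFdeg : F.card * k ≤ ∑ v ∈ F, T.degree v :=
    Finset.card_nsmul_le_sum _ _ _ fun v hv ↦ hdeep v (Finset.mem_filter.1 hv).2
  have hcard : Fintype.card V = S.card + P.card + F.card := by
    simpa using hsplit fun _ ↦ 1
  have hsum := hsplit fun v ↦ T.degree v
  rw [T.sum_degrees_eq_twice_card_edges] at hsum
  have hedge := hT.card_edgeFinset
  obtain ⟨m, rfl⟩ := Nat.exists_eq_add_of_le hk
  have h3 : F.card * (3 + m) = (3 + m - 2) * F.card + 2 * F.card := by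
    rw [show 3 + m - 2 = m + 1 by omega]
    ring
  -- The degree sum is `2 (S + P + F) - 2` and at least `S + (S + P) + k F`, so `(k - 2) F ≤ P - 2`.
  omega

open Classical in
/-- Deep vertices without a penultimate neighbour can be dominated by few vertices. -/
theorem IsTree.exists_dominationNumber_le (hT : T.IsTree) {k : ℕ}
    (hdeep : ∀ v, T.IsDeep v → k ≤ T.degree v) :
    ∃ m : ℕ, T.dominationNumber ≤ (Finset.univ.filter T.IsPenultimate).card + m ∧
      m * (k + 1) ≤ (Finset.univ.filter T.IsDeep).card := by
  set P := Finset.univ.filter T.IsPenultimate with hP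
  obtain ⟨X, Y, hXY, hYU, hdom, hpack⟩ := hT.exists_dominating_packing
    (Finset.univ.filter fun v ↦ T.IsDeep v ∧ ∀ u, T.Adj v u → ¬ T.IsPenultimate u)
  refine ⟨X.card, ?_, ?_⟩
  · have hD : T.IsDominatingSet (P ∪ X) := by
      intro v
      by_cases hv : T.IsPenultimate v
      · exact Or.inl (by simp [hP, hv])
      by_cases hu : ∃ u, T.Adj v u ∧ T.IsPenultimate u
      · obtain ⟨u, hvu, hu⟩ := hu
        exact Or.inr ⟨u, by simp [hP, hu], hvu⟩
      push Not at hu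
      have hvl : ¬ T.IsLeaf v := by
        intro hl
        obtain ⟨x, hx⟩ := Finset.card_pos.1 (show 0 < T.degree v from hl ▸ one_pos)
        have hx' := (T.mem_neighborFinset _ _).1 hx
        exact hu x hx' ⟨v, hx'.symm, hl⟩
      rcases hdom v (Finset.mem_filter.2 ⟨Finset.mem_univ v, ⟨hvl, hv⟩,
        fun u hvu h ↦ hu u hvu h⟩) with h | ⟨x, hx, h⟩
      · exact Or.inl (Finset.mem_union_right _ h)
      · exact Or.inr ⟨x, Finset.mem_union_right _ hx, h⟩
    exact hD.dominationNumber_le.trans (Finset.card_union_le _ _)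
  · refine (Nat.mul_le_mul_right _ hXY).trans ?_
    have hY : ∀ y ∈ Y, T.IsDeep y ∧ ∀ u, T.Adj y u → ¬ T.IsPenultimate u := fun y hy ↦
      (Finset.mem_filter.1 (hYU hy)).2
    have hdisj : (Y : Set V).PairwiseDisjoint fun y ↦ insert y (T.neighborFinset y) := by
      intro y hy y' hy' hne
      refine Finset.disjoint_left.2 fun z hz hz' ↦ hne (hpack y hy y' hy' z ?_ ?_)
      · simpa [adj_comm] using hz
      · simpa [adj_comm] using hz'
    calc Y.card * (k + 1) ≤ ∑ y ∈ Y, (insert y (T.neighborFinset y)).card := by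
          rw [← smul_eq_mul]
          refine Finset.card_nsmul_le_sum _ _ _ fun y hy ↦ ?_
          rw [Finset.card_insert_of_notMem (by simp), card_neighborFinset_eq_degree]
          exact Nat.succ_le_succ (hdeep y (hY y hy).1)
      _ = (Y.biUnion fun y ↦ insert y (T.neighborFinset y)).card :=
          (Finset.card_biUnion hdisj).symm
      _ ≤ _ := by
          -- A leaf next to `y` would make `y` penultimate, so all neighbours of `y` are deep.
          refine Finset.card_le_card fun z hz ↦ ?_
          obtain ⟨y, hy, hz⟩ := Finset.mem_biUnion.1 hz
          refine Finset.mem_filter.2 ⟨Finset.mem_univ _, ?_⟩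
          obtain ⟨hyd, hyp⟩ := hY y hy
          rcases Finset.mem_insert.1 hz with rfl | hz
          · exact hyd
          · have hz' := (T.mem_neighborFinset _ _).1 hz
            exact ⟨fun h ↦ hyd.2 ⟨z, hz', h⟩, hyp z hz'⟩

end Fintype
end SimpleGraph

/-! ### Combining the bounds -/

namespace SimpleGraph

variable {V : Type*} [Fintype V] [DecidableEq V] {T : SimpleGraph V} [DecidableRel T.Adj]

open Classical in
lemma card_penultimate_le_laplacianMu (hlp : ∀ v, T.IsLeaf v → ¬ T.IsPenultimate v) :
    (Finset.univ.filter T.IsPenultimate).card ≤ T.laplacianMu := by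
  choose l hadj hl using fun q : {v // T.IsPenultimate v} ↦ q.2
  rw [← Fintype.card_subtype]
  exact T.card_le_laplacianMu_of_pendant Subtype.val_injective (fun q ↦ (hadj q).symm) hl
    fun p q h ↦ hlp (l q) (hl q) (h ▸ p.2)

omit [DecidableEq V] in
lemma IsTree.dominationNumber_le_one (hT : T.IsTree) {v : V} (hv : T.IsLeaf v)
    (hv' : T.IsPenultimate v) : T.dominationNumber ≤ 1 := by
  obtain ⟨u, hvu, hu⟩ := hv'
  have h : T.IsDominatingSet {v} := fun w ↦ by
    rcases hT.eq_or_adj_of_forall_adj_isLeaf (fun x hx ↦ hv.eq_of_adj hvu hx ▸ hu) w with h | h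
    · simp [h]
    · exact Or.inr ⟨v, by simp, h.symm⟩
  simpa using h.dominationNumber_le

end SimpleGraph

theorem corollary1 {V : Type*} [Fintype V] [DecidableEq V] (T : SimpleGraph V)
    [DecidableRel T.Adj] (hT : T.IsTree) (k : ℕ) (hk : 3 ≤ k)
    (hdeep : ∀ v : V, T.IsDeep v → k ≤ T.degree v) :
    (1 : ℝ) ≤ (T.dominationNumber : ℝ) / (T.laplacianMu : ℝ) ∧
      (T.dominationNumber : ℝ) / (T.laplacianMu : ℝ)
        < 1 + 1 / (((k : ℝ) - 2) * ((k : ℝ) + 1)) := by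
  classical
  have := hT.connected.nonempty
  have hμ : (0 : ℝ) < T.laplacianMu := by exact_mod_cast T.laplacianMu_pos
  have hk3 : (3 : ℝ) ≤ k := by exact_mod_cast hk
  have hk2 : (0 : ℝ) < (k : ℝ) - 2 := by linarith
  have hk1 : (0 : ℝ) < (k : ℝ) + 1 := by linarith
  rw [one_le_div hμ, div_lt_iff₀ hμ]
  refine ⟨by exact_mod_cast T.laplacianMu_le_dominationNumber, ?_⟩
  by_cases hlp : ∀ v, T.IsLeaf v → ¬ T.IsPenultimate v
  · have hP : ((Finset.univ.filter T.IsPenultimate).card : ℝ) ≤ T.laplacianMu := by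
      exact_mod_cast SimpleGraph.card_penultimate_le_laplacianMu hlp
    obtain ⟨m, hγ, hm⟩ := hT.exists_dominationNumber_le hdeep
    have hF := hT.mul_card_deep_lt_card_penultimate hlp hk hdeep
    have hγ' : (T.dominationNumber : ℝ) ≤ (Finset.univ.filter T.IsPenultimate).card + m := by
      exact_mod_cast hγ
    have hm' : (m : ℝ) * (k + 1) ≤ (Finset.univ.filter T.IsDeep).card := by exact_mod_cast hm
    have hF' : ((k : ℝ) - 2) * (Finset.univ.filter T.IsDeep).card <
        (Finset.univ.filter T.IsPenultimate).card := by
      rw [← Nat.cast_ofNat, ← Nat.cast_sub (by omega)]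
      exact_mod_cast hF
    have hmμ : (m : ℝ) < 1 / (((k : ℝ) - 2) * (k + 1)) * T.laplacianMu := by
      rw [one_div_mul_eq_div, lt_div_iff₀ (mul_pos hk2 hk1)]
      calc (m : ℝ) * ((k - 2) * (k + 1)) = (k - 2) * (m * (k + 1)) := by ring
        _ ≤ (k - 2) * (Finset.univ.filter T.IsDeep).card := mul_le_mul_of_nonneg_left hm' hk2.le
        _ < _ := hF'.trans_le hP
    linarith
  -- A penultimate leaf forces a single edge, where `γ ≤ 1 ≤ μ`.
  · push Not at hlp
    obtain ⟨v, hv, hv'⟩ := hlp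
    have h1 : (T.dominationNumber : ℝ) ≤ T.laplacianMu := by
      exact_mod_cast (hT.dominationNumber_le_one hv hv').trans T.laplacianMu_pos
    have : 0 < 1 / (((k : ℝ) - 2) * (k + 1)) * T.laplacianMu := by positivity
    linarith
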